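/- Consider $n$ banks; bank $i$ has a cash shortfall $h_i>0$ and holds $a_i>0$ shares of an illiquid asset. Let $r\ge 0$ be the repo rate, $M\ge\sum_{i=1}^n a_i$, and $D=\prod_{i=1}^n[0,a_i]$. Let $f:[0,M]\to(0,1]$ (the order book density) be strictly decreasing and twice continuously differentiable with $f(0)=1$ and $f'$ nondecreasing. For $s\in D$ let $0=:s_{[0]}\le s_{[1]}\le\dots\le s_{[n]}$ be the order statistics of $s$. The limit order book (LOB) price of bank $i$ is $\bar f_i(s)=1$ if $s_i=0$, and if $s_i=s_{[k]}>0$, $$\bar f_i(s)=\frac1{s_i}\sum_{j=1}^k\frac1{n-(j-1)}\int_{d_{j-1}(s)}^{d_j(s)}f(\sigma)\,d\sigma,\qquad d_j(s)=\sum_{l=1}^{j}(n-(l-1))(s_{[l]}-s_{[l-1]}).$$ Let $g:[0,M]\to(0,1]$ (the haircut function) be continuous, convex and strictly decreasing, with $g(\sum_j s_j)<\bar f_i(s)$ for all $s\in D$ and all $i$, and such that for all $i$ and all $(s_j)_{j\neq i}\in\prod_{j\ne i}[0,a_j]$ the map $s_i\in[0,a_i]\mapsto s_i\bar f_i(s)+(a_i-s_i)\,g(\sum_j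 s_j)$ is strictly increasing. For given $(q,\bar q)=(q,\bar q_1,\dots,\bar q_n)$, call $s\in D$ an equilibrium at $(q,\bar q)$ if for every $i$: either $h_i>a_i\bar q_i$ (insolvency) and $s_i=a_i$; or $h_i\le a_i\bar q_i$ and $s_i$ minimizes $$x\mapsto x\,(1-\bar f_i(x,s_{-i}))+r\,(h_i-x\,\bar f_i(x,s_{-i}))$$ over the set of all $x\in[0,a_i]$ with $\frac{h_i-a_iq}{\bar q_i-q}\le x\le\frac{h_i}{\bar q_i}$. Call $(q,\bar q)$ a clearing haircut and set of clearing prices if there is an equilibrium $s$ at $(q,\bar q)$ with $q=g(\sum_j s_j)$ and $\bar q_i=\bar f_i(s)$ for all $i$. The clearing liquidations are the equilibria at such $(q,\bar q)$. Then, in the componentwise order, there exist a greatest and a least clearing haircut and set of clearing prices, $(q^\uparrow,\bar q^\uparrow_1,\dots,\bar q^\uparrow_n)\ge(q^\downarrow,\bar q^\downarrow_1,\dots,\bar q^\downarrow_n)$. Moreover, the set of clearing liquidations, with the componentwise order, is a lattice (any two of its elements have a least upper bound and a greatest lower bound within the set). -/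

import Mathlib

open Set

namespace FireSale

noncomputable section

/-- The order statistics `0 = s_[0] ≤ s_[1] ≤ ... ≤ s_[n]` of a nonnegative vector `s`.
Indices larger than `n` are never used. -/
def orderStat {n : ℕ} (s : Fin n → ℝ) : ℕ → ℝ
  | 0 => 0
  | j + 1 => if hj : j < n then s (Tuple.sort s ⟨j, hj⟩) else 0

/-- An index `k` in `{1, ..., n}` with `s_i = s_[k]`. -/
def rank {n : ℕ} (s : Fin n → ℝ) (i : Fin n) : ℕ :=
  ((Tuple.sort s).symm i : ℕ) + 1

theorem orderStat_rank {n : ℕ} (s : Fin n → ℝ) (i : Fin n) :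
    orderStat s (rank s i) = s i := by
  simp [orderStat, rank]

/-- `∑_{l=1}^{j} (n - (l-1)) (s_[l] - s_[l-1])`: the depth of the order book that has been
consumed when the `j` smallest orders have been filled. -/
def depth {n : ℕ} (s : Fin n → ℝ) (j : ℕ) : ℝ :=
  ∑ l ∈ Finset.Icc 1 j, ((n : ℝ) - ((l : ℝ) - 1)) * (orderStat s l - orderStat s (l - 1))

/-- The average price of bank `i` in the limit order book (LOB) structure with order book
density `f`, when the banks liquidate the amounts `s`. -/
def lobPrice {n : ℕ} (f : ℝ → ℝ) (s : Fin n → ℝ) (i : Fin n) : ℝ :=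
  if 0 < s i then
    1 / s i * ∑ j ∈ Finset.Icc 1 (rank s i),
      1 / ((n : ℝ) - ((j : ℝ) - 1)) * ∫ σ in (depth s (j - 1))..(depth s j), f σ
  else 1

/-- The set `D = ∏ [0, a_j]` of admissible liquidations. -/
def admissible {n : ℕ} (a : Fin n → ℝ) : Set (Fin n → ℝ) :=
  {s | ∀ j, 0 ≤ s j ∧ s j ≤ a j}

/-- The standing assumption on the order book density `f : [0, M] → (0, 1]`. -/
structure DensityAssumption (M : ℝ) (f : ℝ → ℝ) : Prop where
  range : ∀ x ∈ Icc 0 M, f x ∈ Ioc (0 : ℝ) 1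
  zero : f 0 = 1
  strictAnti : StrictAntiOn f (Icc 0 M)
  contDiff : ContDiffOn ℝ 2 f (Icc 0 M)
  deriv_mono : MonotoneOn (derivWithin f (Icc 0 M)) (Icc 0 M)

/-- The standing assumptions on the haircut function `g : [0, M] → (0, 1]`, relative to the
average prices `p s i` obtained by the banks `i` at the liquidations `s`. -/
structure HaircutAssumption {n : ℕ} (M : ℝ) (a : Fin n → ℝ)
    (p : (Fin n → ℝ) → Fin n → ℝ) (g : ℝ → ℝ) : Prop where
  range : ∀ x ∈ Icc 0 M, g x ∈ Ioc (0 : ℝ) 1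
  continuousOn : ContinuousOn g (Icc 0 M)
  convexOn : ConvexOn ℝ (Icc 0 M) g
  strictAnti : StrictAntiOn g (Icc 0 M)
  lt_price : ∀ s ∈ admissible a, ∀ i, g (∑ j, s j) < p s i
  cash_strictMono : ∀ s ∈ admissible a, ∀ i,
    StrictMonoOn
      (fun x => x * p (Function.update s i x) i
        + (a i - x) * g (∑ j, Function.update s i x j))
      (Icc 0 (a i))

/-- The cost (realized loss plus interest) of bank `i` when it liquidates `x` and the other
banks liquidate according to `s`. -/
def cost {n : ℕ} (r : ℝ) (h : Fin n → ℝ) (p : (Fin n → ℝ) → Fin n → ℝ)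
    (s : Fin n → ℝ) (i : Fin n) (x : ℝ) : ℝ :=
  x * (1 - p (Function.update s i x) i) + r * (h i - x * p (Function.update s i x) i)

/-- The amounts that bank `i` may liquidate at the fixed haircut `q` and the fixed prices `qb`:
it raises no more than its shortfall, and keeps enough collateral for its loan. -/
def feasible {n : ℕ} (a h : Fin n → ℝ) (q : ℝ) (qb : Fin n → ℝ) (i : Fin n) : Set ℝ :=
  {x | 0 ≤ x ∧ x ≤ a i ∧ x ≤ h i / qb i ∧ (h i - a i * q) / (qb i - q) ≤ x}

/-- `s` is a vector of equilibrium liquidations of the game in which the haircut `q` and the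
prices `qb` in the constraints are held fixed: a solvent bank (`h_i ≤ a_i qb_i`) plays a best
response to the other banks, and an insolvent bank liquidates everything it holds. -/
def IsEquilibriumAt {n : ℕ} (r : ℝ) (a h : Fin n → ℝ) (p : (Fin n → ℝ) → Fin n → ℝ)
    (q : ℝ) (qb : Fin n → ℝ) (s : Fin n → ℝ) : Prop :=
  s ∈ admissible a ∧
    ∀ i,
      (h i ≤ a i * qb i →
        s i ∈ feasible a h q qb i ∧
          ∀ x ∈ feasible a h q qb i, cost r h p s i (s i) ≤ cost r h p s i x) ∧
      (a i * qb i < h i → s i = a i)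

/-- The set of clearing haircuts and prices `(q, qb_1, ..., qb_n)`: there are equilibrium
liquidations at `(q, qb)` that reproduce `q` and `qb`. -/
def clearingPrices {n : ℕ} (r : ℝ) (a h : Fin n → ℝ) (p : (Fin n → ℝ) → Fin n → ℝ)
    (g : ℝ → ℝ) : Set (ℝ × (Fin n → ℝ)) :=
  {Q | ∃ s, IsEquilibriumAt r a h p Q.1 Q.2 s ∧ Q.1 = g (∑ j, s j) ∧ ∀ i, Q.2 i = p s i}

/-- The set of clearing liquidations: the equilibrium liquidations at clearing haircuts and
prices. -/
def clearingLiquidations {n : ℕ} (r : ℝ) (a h : Fin n → ℝ) (p : (Fin n → ℝ) → Fin n → ℝ)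
    (g : ℝ → ℝ) : Set (Fin n → ℝ) :=
  {s | ∃ Q ∈ clearingPrices r a h p g, IsEquilibriumAt r a h p Q.1 Q.2 s}

/-- A subset `S` of a partially ordered set is a lattice in the induced order: any two of its
elements have a least upper bound and a greatest lower bound within `S`. -/
def IsLatticeIn {α : Type*} [PartialOrder α] (S : Set α) : Prop :=
  ∀ x y : S, (∃ u : S, IsLUB {x, y} u) ∧ ∃ l : S, IsGLB {x, y} l

end

end FireSale

/-!
Clearing liquidations turn out to be the fixed points of a monotone map on `Icc 0 a`, so that the
theorem is an instance of the Knaster-Tarski theorem; prices and haircut decrease in the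
liquidations, so that extreme liquidations give extreme prices.

The key to the order book is the amount `sold s t = ∑ j, min (s j) t` sold below a common level
`t`. In terms of it, bank `i` raises `∫ t in 0..s i, f (sold s t)`
(`lobPrice_eq_integral`, `mul_integral_eq_proceeds`), so what happens below a level does not
depend on the orders above it, and its cost has the derivative `1 - (1 + r) f (sold s t)`,
which increases in `t`. Hence best responses are described by first order conditions
(`IsMarket.forall_cost_le_iff`).

The best response of a bank decreases in the liquidations of the others as long as it sells for
profit, so the game is not supermodular as it stands. But the profitable sales do not vary: let
`c` be liquidations at which all banks sell until their shortfalls are covered by sales alone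
(`IsMarket.exists_fullSale`), and `T` the level where selling at `c` ceases to be profitable.
Comparing two vectors at the lowest level at which they part (`min_eq_min_of_forall_lowest`)
shows that every clearing vector agrees with `c` below `T`. Above `T`, banks sell only to meet
their collateral constraint, and the amount that takes increases with the liquidations of the
others, since these lower both the proceeds of the bank and the value of its collateral. So
clearing means `s i = max (min (c i) T) (L i s)` for a monotone `L`
(`IsMarket.exists_baseline`). The same comparison shows that the equilibrium at a given haircut and given prices is unique
(`IsMarket.equilibrium_unique`), so every clearing liquidation reproduces its own prices.
-/

namespace FireSale

/-! ### The order book at a common level -/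

/-- The total amount sold when every bank `j` has liquidated the part of its order `s j` that
lies below the common level `t`. -/
noncomputable def sold {n : ℕ} (s : Fin n → ℝ) (t : ℝ) : ℝ := ∑ j, min (s j) t

/-- The cash raised by a bank that has liquidated the amount `t`, when the order book has
density `e` and the orders of all banks, its own included, are `s`. -/
noncomputable def proceeds {n : ℕ} (e : ℝ → ℝ) (s : Fin n → ℝ) (t : ℝ) : ℝ :=
  ∫ τ in (0 : ℝ)..t, e (sold s τ)

/-- The properties of an order book density on `[0, M]` once it is extended to the real line by
its boundary values. -/
structure IsDensity (M : ℝ) (e : ℝ → ℝ) : Prop where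
  continuous : Continuous e
  antitone : Antitone e
  strictAntiOn : StrictAntiOn e (Icc 0 M)
  pos : ∀ x, 0 < e x
  zero : e 0 = 1

theorem DensityAssumption.isDensity_IccExtend {M : ℝ} {f : ℝ → ℝ} (hM : 0 ≤ M)
    (hf : DensityAssumption M f) : IsDensity M (IccExtend hM ((Icc 0 M).domRestrict f)) where
  continuous := (continuousOn_iff_continuous_domRestrict.1 hf.contDiff.continuousOn).Icc_extend'
  antitone x y hxy :=
    hf.strictAnti.antitoneOn (projIcc 0 M hM x).2 (projIcc 0 M hM y).2 (monotone_projIcc hM hxy)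
  strictAntiOn x hx y hy hxy := by
    rw [IccExtend_of_mem hM _ hx, IccExtend_of_mem hM _ hy]
    exact hf.strictAnti hx hy hxy
  pos x := (hf.range _ (projIcc 0 M hM x).2).1
  zero := by
    rw [IccExtend_of_mem hM _ ⟨le_rfl, hM⟩]
    exact hf.zero

theorem mem_admissible {n : ℕ} {a s : Fin n → ℝ} : s ∈ admissible a ↔ s ∈ Icc 0 a :=
  ⟨fun hs => ⟨fun j => (hs j).1, fun j => (hs j).2⟩, fun hs j => ⟨hs.1 j, hs.2 j⟩⟩

theorem continuous_sold {n : ℕ} (s : Fin n → ℝ) : Continuous (sold s) := by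
  unfold sold; fun_prop

theorem sold_mono {n : ℕ} {s s' : Fin n → ℝ} (hs : s ≤ s') {t t' : ℝ} (ht : t ≤ t') :
    sold s t ≤ sold s' t' :=
  Finset.sum_le_sum fun j _ => min_le_min (hs j) ht

theorem sold_lt_sold {n : ℕ} {s : Fin n → ℝ} {i : Fin n} {t t' : ℝ} (ht : t < t')
    (hi : t < s i) : sold s t < sold s t' :=
  Finset.sum_lt_sum (fun j _ => min_le_min le_rfl ht.le)
    ⟨i, Finset.mem_univ _, by rw [min_eq_right hi.le]; exact lt_min hi ht⟩

theorem sold_nonneg {n : ℕ} {s : Fin n → ℝ} (hs : 0 ≤ s) {t : ℝ} (ht : 0 ≤ t) :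
    0 ≤ sold s t :=
  Finset.sum_nonneg fun j _ => le_min (hs j) ht

theorem sold_le_sum {n : ℕ} (s : Fin n → ℝ) (t : ℝ) : sold s t ≤ ∑ j, s j :=
  Finset.sum_le_sum fun _ _ => min_le_left _ _

theorem sold_zero {n : ℕ} {s : Fin n → ℝ} (hs : 0 ≤ s) : sold s 0 = 0 :=
  Finset.sum_eq_zero fun j _ => min_eq_right (hs j)

/-! ### Prices in terms of the amount sold below a level -/

theorem orderStat_mono {n : ℕ} {s : Fin n → ℝ} (hs : 0 ≤ s) {k l : ℕ} (hkl : k ≤ l)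
    (hl : l ≤ n) : orderStat s k ≤ orderStat s l := by
  cases l with
  | zero => rw [Nat.le_zero.1 hkl]
  | succ l =>
    cases k with
    | zero =>
      simp only [orderStat, dif_pos (Nat.lt_of_succ_le hl)]
      exact hs _
    | succ k =>
      have hl' : l < n := Nat.lt_of_succ_le hl
      have hk' : k < n := by omega
      simp only [orderStat, dif_pos hl', dif_pos hk']
      exact Tuple.monotone_sort s (show (⟨k, hk'⟩ : Fin n) ≤ ⟨l, hl'⟩ from by
        simpa using hkl)

theorem depth_succ {n : ℕ} (s : Fin n → ℝ) (k : ℕ) :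
    depth s (k + 1) =
      depth s k + ((n : ℝ) - k) * (orderStat s (k + 1) - orderStat s k) := by
  simp [depth, Finset.sum_Icc_succ_top]

/-- Summation by parts in the definition of the depth. -/
theorem depth_eq_sum {n : ℕ} (s : Fin n → ℝ) (k : ℕ) :
    depth s k =
      ∑ m ∈ Finset.range k, orderStat s (m + 1) + ((n : ℝ) - k) * orderStat s k := by
  induction k with
  | zero => simp [depth, orderStat]
  | succ k ih =>
    rw [depth_succ, ih, Finset.sum_range_succ]
    push_cast
    ring

theorem sold_eq_sum_orderStat {n : ℕ} (s : Fin n → ℝ) (t : ℝ) :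
    sold s t = ∑ m ∈ Finset.range n, min (orderStat s (m + 1)) t := by
  rw [Finset.sum_range, sold, ← Equiv.sum_comp (Tuple.sort s)]
  exact Finset.sum_congr rfl fun m _ => by simp [orderStat]

theorem sold_eq_depth_add {n : ℕ} {s : Fin n → ℝ} (hs : 0 ≤ s) {k : ℕ} (hk : k < n) {t : ℝ}
    (ht : t ∈ Icc (orderStat s k) (orderStat s (k + 1))) :
    sold s t = depth s k + ((n : ℝ) - k) * (t - orderStat s k) := by
  rw [sold_eq_sum_orderStat, depth_eq_sum, ← Finset.sum_range_add_sum_Ico _ hk.le]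
  have h1 : ∑ m ∈ Finset.range k, min (orderStat s (m + 1)) t
      = ∑ m ∈ Finset.range k, orderStat s (m + 1) := by
    refine Finset.sum_congr rfl fun m hm => min_eq_left (le_trans ?_ ht.1)
    exact orderStat_mono hs (Nat.succ_le_of_lt (Finset.mem_range.1 hm)) hk.le
  have h2 : ∑ m ∈ Finset.Ico k n, min (orderStat s (m + 1)) t = ((n : ℝ) - k) * t := by
    rw [Finset.sum_congr rfl (g := fun _ => t), Finset.sum_const, Nat.card_Ico, nsmul_eq_mul,
      Nat.cast_sub hk.le]
    intro m hm
    rw [Finset.mem_Ico] at hm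
    exact min_eq_right (ht.2.trans (orderStat_mono hs (by omega) (by omega)))
  rw [h1, h2]
  ring

theorem depth_eq_sold {n : ℕ} {s : Fin n → ℝ} (hs : 0 ≤ s) {k : ℕ} (hk : k ≤ n) :
    depth s k = sold s (orderStat s k) := by
  cases k with
  | zero => simp [depth, orderStat, sold_zero hs]
  | succ k =>
    have hk' : k < n := hk
    rw [sold_eq_depth_add hs hk' ⟨orderStat_mono hs (Nat.le_succ k) hk, le_rfl⟩, depth_succ]

/-- Filling the orders between two consecutive order statistics: the change of variables from
the depth of the order book to the common level. -/
theorem integral_depth_eq {n : ℕ} {M : ℝ} {f e : ℝ → ℝ} (hfe : EqOn f e (Icc 0 M))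
    {s : Fin n → ℝ} (hs : 0 ≤ s) (hM : ∑ j, s j ≤ M) {k : ℕ} (hk : k < n) :
    1 / ((n : ℝ) - k) * ∫ σ in (depth s k)..(depth s (k + 1)), f σ =
      ∫ t in (orderStat s k)..(orderStat s (k + 1)), e (sold s t) := by
  have hle := orderStat_mono hs (Nat.le_succ k) hk
  have hmem : ∀ l ≤ n, depth s l ∈ Icc 0 M := fun l hl => by
    rw [depth_eq_sold hs hl]
    exact ⟨sold_nonneg hs (orderStat_mono hs (Nat.zero_le l) hl),
      (sold_le_sum _ _).trans hM⟩
  have hc : (n : ℝ) - k ≠ 0 := sub_ne_zero.2 (by exact_mod_cast hk.ne')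
  have h1 : ∫ t in (orderStat s k)..(orderStat s (k + 1)), e (sold s t) =
      ∫ t in (orderStat s k)..(orderStat s (k + 1)),
        e (((n : ℝ) - k) * t + (depth s k - ((n : ℝ) - k) * orderStat s k)) := by
    refine intervalIntegral.integral_congr fun t ht => ?_
    rw [uIcc_of_le hle] at ht
    simp only [sold_eq_depth_add hs hk ht]
    congr 1
    ring
  have h2 : ∫ σ in (depth s k)..(depth s (k + 1)), f σ =
      ∫ σ in (depth s k)..(depth s (k + 1)), e σ :=
    intervalIntegral.integral_congr fun σ hσ =>
      hfe (uIcc_subset_Icc (hmem k hk.le) (hmem (k + 1) hk) hσ)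
  rw [h1, h2, intervalIntegral.integral_comp_mul_add _ hc, smul_eq_mul, one_div, depth_succ]
  congr 2 <;> ring

theorem IsDensity.continuous_comp_sold {n : ℕ} {M : ℝ} {e : ℝ → ℝ} (he : IsDensity M e)
    (s : Fin n → ℝ) : Continuous fun t => e (sold s t) :=
  he.continuous.comp (continuous_sold s)

theorem mul_integral_eq_proceeds {n : ℕ} (e : ℝ → ℝ) (s : Fin n → ℝ) (x : ℝ) :
    x * ∫ v in (0 : ℝ)..1, e (sold s (x * v)) = proceeds e s x := by
  have h := intervalIntegral.mul_integral_comp_mul_left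
    (f := fun t => e (sold s t)) (a := 0) (b := 1) x
  rwa [mul_zero, mul_one] at h

/-- A bank sells at the average density over the levels below its order. -/
theorem lobPrice_eq_integral {n : ℕ} {M : ℝ} {f e : ℝ → ℝ} (hfe : EqOn f e (Icc 0 M))
    (he : IsDensity M e) {s : Fin n → ℝ} (hs : 0 ≤ s) (hM : ∑ j, s j ≤ M) (i : Fin n) :
    lobPrice f s i = ∫ v in (0 : ℝ)..1, e (sold s (s i * v)) := by
  unfold lobPrice
  split_ifs with hi
  · have hr : rank s i ≤ n := Nat.succ_le_of_lt (Fin.is_lt _)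
    have h1 : ∑ j ∈ Finset.Icc 1 (rank s i),
        1 / ((n : ℝ) - ((j : ℝ) - 1)) * ∫ σ in (depth s (j - 1))..(depth s j), f σ =
        ∑ k ∈ Finset.range (rank s i),
          ∫ t in (orderStat s k)..(orderStat s (k + 1)), e (sold s t) := by
      rw [← Finset.Ico_add_one_right_eq_Icc, Finset.sum_Ico_eq_sum_range]
      refine Finset.sum_congr (by simp) fun k hk => ?_
      have hk' : k < n := lt_of_lt_of_le (by simpa using hk) hr
      rw [← integral_depth_eq hfe hs hM hk']
      simp [add_comm 1 k]
    have h0 : orderStat s 0 = 0 := rfl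
    have h2 := intervalIntegral.sum_integral_adjacent_intervals
      (f := fun t => e (sold s t)) (a := orderStat s) (n := rank s i)
      (μ := MeasureTheory.volume) fun k _ => (he.continuous_comp_sold s).intervalIntegrable _ _
    rw [h1, h2, orderStat_rank, h0]
    change 1 / s i * proceeds e s (s i) = _
    rw [← mul_integral_eq_proceeds]
    field_simp
  · have : s i = 0 := le_antisymm (not_lt.1 hi) (hs i)
    simp [this, sold_zero hs, he.zero]

/-! ### Proceeds -/

theorem proceeds_zero {n : ℕ} (e : ℝ → ℝ) (s : Fin n → ℝ) : proceeds e s 0 = 0 :=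
  intervalIntegral.integral_same

theorem proceeds_sub {n : ℕ} {M : ℝ} {e : ℝ → ℝ} (he : IsDensity M e) (s : Fin n → ℝ)
    (x y : ℝ) : proceeds e s y - proceeds e s x = ∫ t in x..y, e (sold s t) :=
  intervalIntegral.integral_interval_sub_left
    ((he.continuous_comp_sold s).intervalIntegrable _ _)
    ((he.continuous_comp_sold s).intervalIntegrable _ _)

theorem continuous_proceeds {n : ℕ} {M : ℝ} {e : ℝ → ℝ} (he : IsDensity M e)
    (s : Fin n → ℝ) : Continuous (proceeds e s) :=
  intervalIntegral.continuous_primitive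
    (fun _ _ => (he.continuous_comp_sold s).intervalIntegrable _ _) 0

theorem strictMono_proceeds {n : ℕ} {M : ℝ} {e : ℝ → ℝ} (he : IsDensity M e)
    (s : Fin n → ℝ) : StrictMono (proceeds e s) := fun x y hxy => by
  rw [← sub_pos, proceeds_sub he]
  exact intervalIntegral.intervalIntegral_pos_of_pos
    ((he.continuous_comp_sold s).intervalIntegrable _ _) (fun _ => he.pos _) hxy

theorem proceeds_antitone {n : ℕ} {M : ℝ} {e : ℝ → ℝ} (he : IsDensity M e)
    {s s' : Fin n → ℝ} (hs : s ≤ s') {x : ℝ} (hx : 0 ≤ x) :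
    proceeds e s' x ≤ proceeds e s x :=
  intervalIntegral.integral_mono_on hx
    ((he.continuous_comp_sold _).intervalIntegrable _ _)
    ((he.continuous_comp_sold _).intervalIntegrable _ _)
    fun _ _ => he.antitone (sold_mono hs le_rfl)

theorem sold_congr {n : ℕ} {s s' : Fin n → ℝ} {t : ℝ} (h : ∀ j, min (s j) t = min (s' j) t) :
    sold s t = sold s' t :=
  Finset.sum_congr rfl fun j _ => h j

theorem min_eq_min_of_le {x y T t : ℝ} (h : min x T = min y T) (ht : t ≤ T) :
    min x t = min y t := by
  rw [← min_eq_right ht, ← min_assoc, h, min_assoc]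

/-- What a bank earns below the level `x` does not depend on the orders above `x`. -/
theorem proceeds_congr {n : ℕ} (e : ℝ → ℝ) {s s' : Fin n → ℝ} {x : ℝ} (hx : 0 ≤ x)
    (h : ∀ j, min (s j) x = min (s' j) x) : proceeds e s x = proceeds e s' x := by
  refine intervalIntegral.integral_congr fun t ht => ?_
  rw [uIcc_of_le hx] at ht
  simp only [sold_congr fun j => min_eq_min_of_le (h j) ht.2]

/-- Two vectors agree below the level `T` if there is no lowest level at which they part: at an
index `i` where the truncations differ and `min (s i) (s' i)` is minimal, the two vectors agree
below `min (s i) (s' i)`. -/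
theorem min_eq_min_of_forall_lowest {n : ℕ} {s s' : Fin n → ℝ} {T : ℝ}
    (H : ∀ i, min (s i) T ≠ min (s' i) T →
      (∀ j, min (s j) (min (s i) (s' i)) = min (s' j) (min (s i) (s' i))) → False) :
    ∀ i, min (s i) T = min (s' i) T := by
  by_contra! hne
  obtain ⟨i, hi, hmin⟩ := Finset.exists_min_image
    (Finset.univ.filter fun i => min (s i) T ≠ min (s' i) T) (fun i => min (s i) (s' i))
    (by obtain ⟨i, hi⟩ := hne; exact ⟨i, by simpa using hi⟩)
  simp only [Finset.mem_filter, Finset.mem_univ, true_and] at hi hmin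
  refine H i hi fun j => ?_
  by_cases hj : min (s j) T = min (s' j) T
  · refine min_eq_min_of_le hj ?_
    by_contra! hT
    rw [lt_min_iff] at hT
    exact hi (by rw [min_eq_right hT.1.le, min_eq_right hT.2.le])
  · have := le_min_iff.1 (hmin j hj)
    have h1 := (hmin j hj).trans (min_le_left _ _)
    have h2 := (hmin j hj).trans (min_le_right _ _)
    rw [min_eq_right h1, min_eq_right h2]

/-! ### Optimization and monotone fixed points -/

/-- First order conditions for the minimum of a convex function `U` with derivative `u` on an
interval. -/
theorem forall_mem_Icc_le_iff {u U : ℝ → ℝ} (hu : Continuous u) (hmono : Monotone u)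
    {lo hi y : ℝ} (hy : y ∈ Icc lo hi)
    (hU : ∀ x ∈ Icc lo hi, U y - U x = ∫ t in x..y, u t) :
    (∀ x ∈ Icc lo hi, U y ≤ U x) ↔ (lo < y → u y ≤ 0) ∧ (y < hi → 0 ≤ u y) := by
  constructor
  · refine fun hmin => ⟨fun hlo => ?_, fun hhi => ?_⟩
    · by_contra! hpos
      obtain ⟨x, hx, hxy⟩ := (((hu.continuousAt.eventually (lt_mem_nhds hpos)).filter_mono
        nhdsWithin_le_nhds).and (Ioo_mem_nhdsLT hlo)).exists
      have hx' : x ∈ Icc lo hi := ⟨hxy.1.le, hxy.2.le.trans hy.2⟩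
      have h1 : 0 < ∫ t in x..y, u t :=
        intervalIntegral.intervalIntegral_pos_of_pos_on (hu.intervalIntegrable _ _)
          (fun t ht => hx.trans_le (hmono ht.1.le)) hxy.2
      linarith [hmin x hx', hU x hx']
    · by_contra! hneg
      obtain ⟨x, hx, hxy⟩ := (((hu.continuousAt.eventually (gt_mem_nhds hneg)).filter_mono
        nhdsWithin_le_nhds).and (Ioo_mem_nhdsGT hhi)).exists
      have hx' : x ∈ Icc lo hi := ⟨hy.1.trans hxy.1.le, hxy.2.le⟩
      have h1 : 0 < ∫ t in y..x, -u t :=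
        intervalIntegral.intervalIntegral_pos_of_pos_on (hu.neg.intervalIntegrable _ _)
          (fun t ht => neg_pos.2 ((hmono ht.2.le).trans_lt hx)) hxy.1
      rw [intervalIntegral.integral_neg, ← intervalIntegral.integral_symm] at h1
      linarith [hmin x hx', hU x hx']
  · rintro ⟨h1, h2⟩ x hx
    rcases le_total x y with hxy | hxy
    · rcases hxy.eq_or_lt with rfl | hlt
      · exact le_rfl
      have h3 := h1 (hx.1.trans_lt hlt)
      have h4 : 0 ≤ ∫ t in x..y, -u t := intervalIntegral.integral_nonneg hxy
        fun t ht => neg_nonneg.2 ((hmono ht.2).trans h3)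
      rw [intervalIntegral.integral_neg] at h4
      linarith [hU x hx]
    · rcases hxy.eq_or_lt with rfl | hlt
      · exact le_rfl
      have h3 := h2 (hlt.trans_le hx.2)
      have h4 : 0 ≤ ∫ t in y..x, u t := intervalIntegral.integral_nonneg hxy
        fun t ht => h3.trans (hmono ht.1)
      rw [intervalIntegral.integral_symm] at h4
      linarith [hU x hx]

/-- The last point of `[0, a]` at which `k` does not exceed `h`, or `0` if there is none. -/
noncomputable def lastBelow (k : ℝ → ℝ) (a h : ℝ) : ℝ :=
  sSup {x | x ∈ Icc 0 a ∧ (k x ≤ h ∨ x = 0)}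

theorem lastBelow_mem {k : ℝ → ℝ} {a h : ℝ} (ha : 0 ≤ a) (hk : ContinuousOn k (Icc 0 a)) :
    lastBelow k a h ∈ {x | x ∈ Icc 0 a ∧ (k x ≤ h ∨ x = 0)} := by
  refine IsCompact.sSup_mem ?_ ⟨0, ⟨le_rfl, ha⟩, Or.inr rfl⟩
  refine isCompact_Icc.of_isClosed_subset ?_ fun x hx => hx.1
  have : {x | x ∈ Icc 0 a ∧ (k x ≤ h ∨ x = 0)} = (Icc 0 a ∩ k ⁻¹' Iic h) ∪ (Icc 0 a ∩ {0}) := by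
    ext x
    simp only [mem_ofPred_eq, mem_union, mem_inter_iff, mem_preimage, mem_Iic,
      mem_singleton_iff, ← and_or_left]
  rw [this]
  exact (hk.preimage_isClosed_of_isClosed isClosed_Icc isClosed_Iic).union
    (isClosed_Icc.inter isClosed_singleton)

theorem le_lastBelow {k : ℝ → ℝ} {a h x : ℝ} (hx : x ∈ Icc 0 a) (hk : k x ≤ h) :
    x ≤ lastBelow k a h :=
  le_csSup ⟨a, fun _ hy => hy.1.2⟩ ⟨hx, Or.inl hk⟩

theorem le_apply_lastBelow {k : ℝ → ℝ} {a h : ℝ} (ha : 0 ≤ a) (hk : ContinuousOn k (Icc 0 a))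
    (hlt : lastBelow k a h < a) : h ≤ k (lastBelow k a h) := by
  have hmem := (lastBelow_mem (h := h) ha hk).1
  have ht : Filter.Tendsto k (nhdsWithin (lastBelow k a h) (Ioc (lastBelow k a h) a))
      (nhds (k (lastBelow k a h))) :=
    (hk _ hmem).mono_left (nhdsWithin_mono _ fun x hx => ⟨hmem.1.trans hx.1.le, hx.2⟩)
  have : (nhdsWithin (lastBelow k a h) (Ioc (lastBelow k a h) a)).NeBot := by
    rw [nhdsWithin_Ioc_eq_nhdsGT hlt]
    infer_instance
  refine ge_of_tendsto ht (eventually_mem_nhdsWithin.mono fun x hx => ?_)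
  by_contra! hxk
  exact hx.1.not_ge (le_lastBelow ⟨hmem.1.trans hx.1.le, hx.2⟩ hxk.le)

theorem lastBelow_mono {k k' : ℝ → ℝ} {a h : ℝ} (ha : 0 ≤ a)
    (hkk : ∀ x ∈ Icc 0 a, k' x ≤ k x) : lastBelow k a h ≤ lastBelow k' a h :=
  csSup_le_csSup ⟨a, fun _ hy => hy.1.2⟩ ⟨0, ⟨le_rfl, ha⟩, Or.inr rfl⟩
    fun x hx => ⟨hx.1, hx.2.imp_left (hkk x hx.1).trans⟩

/-- Where a continuous decreasing function that is nonnegative at `0` crosses zero in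
`[0, A]`. -/
theorem exists_zero_crossing {m : ℝ → ℝ} (hm : Continuous m) (h0 : 0 ≤ m 0) {A : ℝ}
    (hA : 0 ≤ A) : ∃ T ∈ Icc 0 A, 0 ≤ m T ∧ (T < A → m T = 0) := by
  by_cases h : 0 ≤ m A
  · exact ⟨A, ⟨hA, le_rfl⟩, h, fun hlt => (lt_irrefl _ hlt).elim⟩
  · obtain ⟨T, hT, hT0⟩ := intermediate_value_Icc' hA hm.continuousOn ⟨(not_le.1 h).le, h0⟩
    exact ⟨T, hT, hT0.ge, fun _ => hT0⟩

/-- The Knaster-Tarski theorem for a map that is monotone on an interval. -/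
theorem knaster_tarski_Icc {α : Type*} [ConditionallyCompleteLattice α] {a b : α} (hab : a ≤ b)
    {Φ : α → α} (hmaps : MapsTo Φ (Icc a b) (Icc a b)) (hmono : MonotoneOn Φ (Icc a b)) :
    (∃ l, IsLeast {s | s ∈ Icc a b ∧ Φ s = s} l) ∧
      (∃ u, IsGreatest {s | s ∈ Icc a b ∧ Φ s = s} u) ∧
        IsLatticeIn {s | s ∈ Icc a b ∧ Φ s = s} := by
  classical
  have : Fact (a ≤ b) := ⟨hab⟩
  let F : Icc a b →o Icc a b :=
    ⟨fun s => ⟨Φ s, hmaps s.2⟩, fun s t hst => hmono s.2 t.2 hst⟩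
  have hF : ∀ s (hs : s ∈ Icc a b), Φ s = s → (⟨s, hs⟩ : Icc a b) ∈ Function.fixedPoints F :=
    fun s hs h => Subtype.ext h
  have hF' : ∀ s : Function.fixedPoints F, (s.1.1 ∈ Icc a b ∧ Φ s.1.1 = s.1.1) :=
    fun s => ⟨s.1.2, congrArg Subtype.val s.2⟩
  refine ⟨⟨F.lfp.1, ⟨F.lfp.2, congrArg Subtype.val F.isLeast_lfp.1⟩, fun s hs =>
    F.isLeast_lfp.2 (hF s hs.1 hs.2)⟩, ⟨F.gfp.1, ⟨F.gfp.2, congrArg Subtype.val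
    F.isGreatest_gfp.1⟩, fun s hs => F.isGreatest_gfp.2 (hF s hs.1 hs.2)⟩, ?_⟩
  intro x y
  let x' : Function.fixedPoints F := ⟨⟨x.1, x.2.1⟩, hF _ _ x.2.2⟩
  let y' : Function.fixedPoints F := ⟨⟨y.1, y.2.1⟩, hF _ _ y.2.2⟩
  refine ⟨⟨⟨(x' ⊔ y').1.1, hF' _⟩, ?_⟩, ⟨⟨(x' ⊓ y').1.1, hF' _⟩, ?_⟩⟩
  · constructor
    · rintro z (rfl | rfl)
      · exact (le_sup_left : x' ≤ x' ⊔ y')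
      · exact (le_sup_right : y' ≤ x' ⊔ y')
    · intro z hz
      let z' : Function.fixedPoints F := ⟨⟨z.1, z.2.1⟩, hF _ _ z.2.2⟩
      have hx : x' ≤ z' := hz (Or.inl rfl)
      have hy : y' ≤ z' := hz (Or.inr rfl)
      exact (sup_le hx hy : x' ⊔ y' ≤ z')
  · constructor
    · rintro z (rfl | rfl)
      · exact (inf_le_left : x' ⊓ y' ≤ x')
      · exact (inf_le_right : x' ⊓ y' ≤ y')
    · intro z hz
      let z' : Function.fixedPoints F := ⟨⟨z.1, z.2.1⟩, hF _ _ z.2.2⟩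
      have hx : z' ≤ x' := hz (Or.inl rfl)
      have hy : z' ≤ y' := hz (Or.inr rfl)
      exact (le_inf hx hy : z' ≤ x' ⊓ y')

/-! ### Best responses -/

/-- The data of the game: holdings `a`, shortfalls `h`, repo rate `r`, haircut function `g` and
prices `p`, the latter given by an order book whose density extends to `e` on the real line. -/
structure IsMarket {n : ℕ} (M r : ℝ) (a h : Fin n → ℝ) (e g : ℝ → ℝ)
    (p : (Fin n → ℝ) → Fin n → ℝ) : Prop where
  rate_nonneg : 0 ≤ r
  holding_pos : ∀ i, 0 < a i
  shortfall_pos : ∀ i, 0 < h i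
  sum_le : ∑ i, a i ≤ M
  density : IsDensity M e
  price_eq : ∀ s ∈ Icc 0 a, ∀ i, p s i = ∫ v in (0 : ℝ)..1, e (sold s (s i * v))
  haircut : HaircutAssumption M a p g

/-- The marginal gain of a bank from liquidating more when it has liquidated `t`: the loan and
the interest it saves per share, net of the book value of the share. -/
noncomputable def margin {n : ℕ} (r : ℝ) (e : ℝ → ℝ) (s : Fin n → ℝ) (t : ℝ) : ℝ :=
  (1 + r) * e (sold s t) - 1

/-- The cash that bank `i` can raise when it liquidates `x` and the others follow `s`: the
proceeds of the sale and a loan against the remaining shares. Setting the order of bank `i` to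
its maximum `a i` leaves the proceeds below the level `x` unchanged and makes the dependence on
`x` explicit. -/
noncomputable def cash {n : ℕ} (a : Fin n → ℝ) (e g : ℝ → ℝ) (s : Fin n → ℝ) (i : Fin n)
    (x : ℝ) : ℝ :=
  proceeds e (Function.update s i (a i)) x
    + (a i - x) * g (∑ j, Function.update s i x j)

theorem update_mem_Icc {n : ℕ} {a s : Fin n → ℝ} (hs : s ∈ Icc 0 a) {i : Fin n} {x : ℝ}
    (hx : x ∈ Icc 0 (a i)) : Function.update s i x ∈ Icc 0 a := by
  refine ⟨fun j => ?_, fun j => ?_⟩ <;> rcases eq_or_ne j i with rfl | hj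
  · simpa using hx.1
  · simpa [hj] using hs.1 j
  · simpa using hx.2
  · simpa [hj] using hs.2 j

theorem min_update_eq {n : ℕ} (s : Fin n → ℝ) {i : Fin n} {x y t : ℝ} (hx : t ≤ x)
    (hy : t ≤ y) (j : Fin n) :
    min (Function.update s i x j) t = min (Function.update s i y j) t := by
  rcases eq_or_ne j i with rfl | hj
  · simp [hx, hy]
  · simp [hj]

theorem min_update_self_eq {n : ℕ} (s : Fin n → ℝ) {i : Fin n} {x t : ℝ} (hx : t ≤ x)
    (ht : t ≤ s i) (j : Fin n) : min (Function.update s i x j) t = min (s j) t := by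
  conv_rhs => rw [← Function.update_eq_self i s]
  exact min_update_eq s hx ht j

theorem feasible_eq_Icc (a h : Fin n → ℝ) (q : ℝ) (qb : Fin n → ℝ)
    (i : Fin n) : feasible a h q qb i =
      Icc (max 0 ((h i - a i * q) / (qb i - q))) (min (a i) (h i / qb i)) := by
  ext x
  simp only [feasible, mem_ofPred_eq, mem_Icc, max_le_iff, le_min_iff]
  tauto

namespace IsMarket

variable {n : ℕ} {M r : ℝ} {a h : Fin n → ℝ} {e g : ℝ → ℝ} {p : (Fin n → ℝ) → Fin n → ℝ}
  {s s' : Fin n → ℝ} {i : Fin n}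

theorem sum_mem (H : IsMarket M r a h e g p) (hs : s ∈ Icc 0 a) : ∑ j, s j ∈ Icc 0 M :=
  ⟨Finset.sum_nonneg fun j _ => hs.1 j,
    (Finset.sum_le_sum fun j _ => hs.2 j).trans H.sum_le⟩

theorem sold_mem (H : IsMarket M r a h e g p) (hs : s ∈ Icc 0 a) {t : ℝ} (ht : 0 ≤ t) :
    sold s t ∈ Icc 0 M :=
  ⟨sold_nonneg hs.1 ht, (sold_le_sum s t).trans (H.sum_mem hs).2⟩

theorem mul_price (H : IsMarket M r a h e g p) (hs : s ∈ Icc 0 a) (i : Fin n) :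
    s i * p s i = proceeds e s (s i) := by
  rw [H.price_eq s hs, mul_integral_eq_proceeds]

theorem haircut_pos (H : IsMarket M r a h e g p) (hs : s ∈ Icc 0 a) : 0 < g (∑ j, s j) :=
  (H.haircut.range _ (H.sum_mem hs)).1

theorem haircut_lt_price (H : IsMarket M r a h e g p) (hs : s ∈ Icc 0 a) (i : Fin n) :
    g (∑ j, s j) < p s i :=
  H.haircut.lt_price s (mem_admissible.2 hs) i

theorem haircut_antitone (H : IsMarket M r a h e g p) (hs : s ∈ Icc 0 a) (hs' : s' ∈ Icc 0 a)
    (hss : s ≤ s') : g (∑ j, s' j) ≤ g (∑ j, s j) :=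
  H.haircut.strictAnti.antitoneOn (H.sum_mem hs) (H.sum_mem hs')
    (Finset.sum_le_sum fun j _ => hss j)

theorem price_antitone (H : IsMarket M r a h e g p) (hs : s ∈ Icc 0 a) (hs' : s' ∈ Icc 0 a)
    (hss : s ≤ s') : p s' ≤ p s := fun i => by
  rw [H.price_eq s hs, H.price_eq s' hs']
  refine intervalIntegral.integral_mono_on zero_le_one
    (Continuous.intervalIntegrable ?_ _ _) (Continuous.intervalIntegrable ?_ _ _)
    fun v hv => H.density.antitone (sold_mono hss (mul_le_mul_of_nonneg_right (hss i) hv.1))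
  · exact (H.density.continuous_comp_sold s').comp (continuous_const_mul _)
  · exact (H.density.continuous_comp_sold s).comp (continuous_const_mul _)

theorem mul_price_update (H : IsMarket M r a h e g p) (hs : s ∈ Icc 0 a) {x : ℝ}
    (hx : x ∈ Icc 0 (a i)) :
    x * p (Function.update s i x) i = proceeds e (Function.update s i (a i)) x := by
  have := H.mul_price (update_mem_Icc hs hx) i
  rw [Function.update_self] at this
  rw [this]
  exact proceeds_congr e hx.1 (min_update_eq s le_rfl hx.2)

theorem proceeds_update (hs : s ∈ Icc 0 a) (e : ℝ → ℝ) {t : ℝ} (ht : 0 ≤ t) (hts : t ≤ s i) :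
    proceeds e (Function.update s i (a i)) t = proceeds e s t :=
  proceeds_congr e ht (min_update_self_eq s (hts.trans (hs.2 i)) hts)

theorem cash_self (hs : s ∈ Icc 0 a) (e g : ℝ → ℝ) (i : Fin n) :
    cash a e g s i (s i) = proceeds e s (s i) + (a i - s i) * g (∑ j, s j) := by
  rw [cash, proceeds_update hs e (hs.1 i) le_rfl, Function.update_eq_self]

theorem cash_strictMonoOn (H : IsMarket M r a h e g p) (hs : s ∈ Icc 0 a) (i : Fin n) :
    StrictMonoOn (cash a e g s i) (Icc 0 (a i)) :=
  (H.haircut.cash_strictMono s (mem_admissible.2 hs) i).congr fun x hx => by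
    simp only [cash, H.mul_price_update hs hx]

theorem cash_continuousOn (H : IsMarket M r a h e g p) (hs : s ∈ Icc 0 a) (i : Fin n) :
    ContinuousOn (cash a e g s i) (Icc 0 (a i)) := by
  refine (continuous_proceeds H.density _).continuousOn.add
    ((continuous_sub_left (a i)).continuousOn.mul
      (H.haircut.continuousOn.comp (Continuous.continuousOn ?_)
        fun x hx => H.sum_mem (update_mem_Icc hs hx)))
  have hup : Continuous fun x : ℝ => Function.update s i x :=
    continuous_const.update i continuous_id
  exact continuous_finsetSum _ fun j _ => (continuous_apply j).comp hup

theorem cash_antitone (H : IsMarket M r a h e g p) (hs : s ∈ Icc 0 a) (hs' : s' ∈ Icc 0 a)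
    (hss : s ≤ s') {x : ℝ} (hx : x ∈ Icc 0 (a i)) :
    cash a e g s' i x ≤ cash a e g s i x := by
  have hup : ∀ y : ℝ, Function.update s i y ≤ Function.update s' i y := fun y =>
    update_le_update_iff.2 ⟨le_rfl, fun j _ => hss j⟩
  exact add_le_add (proceeds_antitone H.density (hup _) hx.1)
    (mul_le_mul_of_nonneg_left
      (H.haircut_antitone (update_mem_Icc hs hx) (update_mem_Icc hs' hx) (hup x))
      (sub_nonneg.2 hx.2))

theorem margin_antitone (H : IsMarket M r a h e g p) (s : Fin n → ℝ) :
    Antitone (margin r e s) := fun _ _ hxy =>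
  sub_le_sub_right (mul_le_mul_of_nonneg_left (H.density.antitone (sold_mono le_rfl hxy))
    (by linarith [H.rate_nonneg])) _

theorem margin_lt_margin (H : IsMarket M r a h e g p) (hs : s ∈ Icc 0 a) {t t' : ℝ}
    (ht : 0 ≤ t) (htt : t < t') (hi : t < s i) : margin r e s t' < margin r e s t :=
  sub_lt_sub_right (mul_lt_mul_of_pos_left (H.density.strictAntiOn (H.sold_mem hs ht)
    (H.sold_mem hs (ht.trans htt.le)) (sold_lt_sold htt hi))
      (by linarith [H.rate_nonneg])) _

theorem continuous_margin (H : IsMarket M r a h e g p) (s : Fin n → ℝ) :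
    Continuous (margin r e s) :=
  ((H.density.continuous_comp_sold s).const_mul _).sub continuous_const

theorem margin_zero_nonneg (H : IsMarket M r a h e g p) (hs : s ∈ Icc 0 a) :
    0 ≤ margin r e s 0 := by
  rw [margin, sold_zero hs.1, H.density.zero]
  linarith [H.rate_nonneg]

theorem margin_congr {t : ℝ} (r : ℝ) (e : ℝ → ℝ)
    (hss : ∀ j, min (s j) t = min (s' j) t) : margin r e s t = margin r e s' t := by
  rw [margin, margin, sold_congr hss]

theorem cost_eq (H : IsMarket M r a h e g p) (hs : s ∈ Icc 0 a) {x : ℝ}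
    (hx : x ∈ Icc 0 (a i)) :
    cost r h p s i x = x - (1 + r) * proceeds e (Function.update s i (a i)) x + r * h i := by
  rw [cost, ← H.mul_price_update hs hx]
  ring

theorem cost_sub_cost (H : IsMarket M r a h e g p) (hs : s ∈ Icc 0 a) {x y : ℝ}
    (hx : x ∈ Icc 0 (a i)) (hy : y ∈ Icc 0 (a i)) :
    cost r h p s i y - cost r h p s i x =
      ∫ t in x..y, -margin r e (Function.update s i (a i)) t := by
  have h1 : ∀ t, -margin r e (Function.update s i (a i)) t =
      1 - (1 + r) * e (sold (Function.update s i (a i)) t) := fun t => by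
    rw [margin]
    ring
  simp only [h1]
  rw [intervalIntegral.integral_sub intervalIntegrable_const
    (((H.density.continuous_comp_sold _).intervalIntegrable _ _).const_mul _),
    intervalIntegral.integral_const_mul, ← proceeds_sub H.density, H.cost_eq hs hx,
    H.cost_eq hs hy, intervalIntegral.integral_const, smul_eq_mul]
  ring

/-- Best responses of a bank that is constrained to an interval. -/
theorem forall_cost_le_iff (H : IsMarket M r a h e g p) (hs : s ∈ Icc 0 a) {lo hi : ℝ}
    (hlo : 0 ≤ lo) (hhi : hi ≤ a i) (hi' : s i ∈ Icc lo hi) :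
    (∀ x ∈ Icc lo hi, cost r h p s i (s i) ≤ cost r h p s i x) ↔
      (lo < s i → 0 ≤ margin r e s (s i)) ∧ (s i < hi → margin r e s (s i) ≤ 0) := by
  have hsub : Icc lo hi ⊆ Icc 0 (a i) := Icc_subset_Icc hlo hhi
  rw [forall_mem_Icc_le_iff (H.continuous_margin (Function.update s i (a i))).neg
    (H.margin_antitone _).neg hi' fun x hx => H.cost_sub_cost hs (hsub hx) (hsub hi')]
  rw [Pi.neg_apply, margin_congr r e (min_update_self_eq s (hs.2 i) le_rfl), neg_nonpos,
    neg_nonneg]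

/-- At given constraints the equilibrium is unique: at the lowest level at which two equilibria
part, a bank stops in one of them although it has not met its upper bound, and continues in the
other one although it is above its lower bound and more is sold. -/
theorem equilibrium_unique (H : IsMarket M r a h e g p) {q : ℝ} {qb : Fin n → ℝ}
    (hs : IsEquilibriumAt r a h p q qb s) (hs' : IsEquilibriumAt r a h p q qb s') :
    s = s' := by
  have hm := mem_admissible.1 hs.1
  have hm' := mem_admissible.1 hs'.1
  have key : ∀ s s' : Fin n → ℝ, IsEquilibriumAt r a h p q qb s →
      IsEquilibriumAt r a h p q qb s' → ∀ i, s i < s' i →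
      (∀ j, min (s j) (s i) = min (s' j) (s i)) → False := by
    intro s s' hs hs' i hlt hagree
    have hm := mem_admissible.1 hs.1
    have hm' := mem_admissible.1 hs'.1
    have hsol : h i ≤ a i * qb i := by
      by_contra! hins
      exact absurd (hs'.1 i).2 (by rw [← (hs.2 i).2 hins]; exact hlt.not_ge)
    obtain ⟨hf, hopt⟩ := (hs.2 i).1 hsol
    obtain ⟨hf', hopt'⟩ := (hs'.2 i).1 hsol
    rw [feasible_eq_Icc] at hf hopt hf' hopt'
    have h1 := ((H.forall_cost_le_iff hm (le_max_left _ _) (min_le_left _ _) hf).1 hopt).2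
      (hlt.trans_le hf'.2)
    have h2 := ((H.forall_cost_le_iff hm' (le_max_left _ _) (min_le_left _ _) hf').1 hopt').1
      (hf.1.trans_lt hlt)
    have h3 := H.margin_lt_margin hm' (hm.1 i) hlt hlt
    rw [margin_congr r e hagree] at h1
    linarith
  have hmin := min_eq_min_of_forall_lowest (s := s) (s' := s') (T := ∑ j, a j)
    fun i hi hagree => by
      rcases lt_trichotomy (s i) (s' i) with hlt | heq | hlt
      · rw [min_eq_left hlt.le] at hagree
        exact key s s' hs hs' i hlt hagree
      · exact hi (by rw [heq])
      · rw [min_eq_right hlt.le] at hagree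
        exact key s' s hs' hs i hlt fun j => (hagree j).symm
  have hle : ∀ i, a i ≤ ∑ j, a j := fun i =>
    Finset.single_le_sum (fun j _ => (H.holding_pos j).le) (Finset.mem_univ i)
  funext i
  have := hmin i
  rwa [min_eq_left ((hm.2 i).trans (hle i)), min_eq_left ((hm'.2 i).trans (hle i))] at this

/-! ### Clearing liquidations as fixed points of a monotone map -/

/-- The clearing conditions in terms of levels: a solvent bank raises at most its shortfall by
selling, and at least its shortfall with its loan; it sells more than the latter needs only if
this is profitable, and less than the former allows only if more is not. -/
theorem isEquilibriumAt_iff (H : IsMarket M r a h e g p) (hs : s ∈ Icc 0 a) :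
    IsEquilibriumAt r a h p (g (∑ j, s j)) (p s) s ↔
      ∀ i, (a i * p s i < h i → s i = a i) ∧
        (h i ≤ a i * p s i → proceeds e s (s i) ≤ h i ∧ h i ≤ cash a e g s i (s i) ∧
          (h i < cash a e g s i (s i) → 0 ≤ margin r e s (s i)) ∧
          (s i < a i → proceeds e s (s i) < h i → margin r e s (s i) ≤ 0)) := by
  rw [IsEquilibriumAt, and_iff_right (mem_admissible.2 hs)]
  refine forall_congr' fun i => ?_
  rw [and_comm]
  refine and_congr_right' (imp_congr_right fun hsol => ?_)
  have hq := H.haircut_lt_price hs i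
  have hp : 0 < p s i := (H.haircut_pos hs).trans hq
  have hq' := sub_pos.2 hq
  rw [feasible_eq_Icc, cash_self hs, ← H.mul_price hs]
  have hup : s i ≤ h i / p s i ↔ s i * p s i ≤ h i := le_div_iff₀ hp
  have hup' : s i < h i / p s i ↔ s i * p s i < h i := lt_div_iff₀ hp
  have hlo : (h i - a i * g (∑ j, s j)) / (p s i - g (∑ j, s j)) ≤ s i ↔
      h i ≤ s i * p s i + (a i - s i) * g (∑ j, s j) := by
    rw [div_le_iff₀ hq']
    constructor <;> intro <;> linarith
  have hlo' : (h i - a i * g (∑ j, s j)) / (p s i - g (∑ j, s j)) < s i ↔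
      h i < s i * p s i + (a i - s i) * g (∑ j, s j) := by
    rw [div_lt_iff₀ hq']
    constructor <;> intro <;> linarith
  constructor
  · rintro ⟨hf, hopt⟩
    have hopt' := (H.forall_cost_le_iff hs (le_max_left _ _) (min_le_left _ _) hf).1 hopt
    refine ⟨hup.1 (le_min_iff.1 hf.2).2, hlo.1 (max_le_iff.1 hf.1).2, fun hc => ?_,
      fun h1 h2 => hopt'.2 (lt_min h1 (hup'.2 h2))⟩
    rcases (hs.1 i).eq_or_lt with h0 | h0
    · rw [← h0]
      exact H.margin_zero_nonneg hs
    · exact hopt'.1 (max_lt h0 (hlo'.2 hc))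
  · rintro ⟨h1, h2, h3, h4⟩
    have hf : s i ∈ Icc (max 0 ((h i - a i * g (∑ j, s j)) / (p s i - g (∑ j, s j))))
        (min (a i) (h i / p s i)) := ⟨max_le (hs.1 i) (hlo.2 h2), le_min (hs.2 i) (hup.2 h1)⟩
    exact ⟨hf, (H.forall_cost_le_iff hs (le_max_left _ _) (min_le_left _ _) hf).2
      ⟨fun hlt => h3 (hlo'.1 ((le_max_right _ _).trans_lt hlt)),
        fun hlt => h4 (hlt.trans_le (min_le_left _ _))
          (hup'.1 (hlt.trans_le (min_le_right _ _)))⟩⟩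

/-- Liquidations `c` at which every bank sells until it has raised its shortfall by sales alone
or has nothing left. -/
theorem exists_fullSale (H : IsMarket M r a h e g p) :
    ∃ c ∈ Icc 0 a, ∀ i, proceeds e c (c i) ≤ h i ∧ (c i < a i → proceeds e c (c i) = h i) := by
  have ha : (0 : Fin n → ℝ) ≤ a := fun i => (H.holding_pos i).le
  have hcont : ∀ (s : Fin n → ℝ) (i : Fin n), ContinuousOn (proceeds e s) (Icc 0 (a i)) :=
    fun s i => (continuous_proceeds H.density s).continuousOn
  obtain ⟨⟨c, hc, -⟩, -⟩ := knaster_tarski_Icc ha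
    (Φ := fun s i => lastBelow (proceeds e s) (a i) (h i))
    (fun s _ => ⟨fun i => (lastBelow_mem (ha i) (hcont s i)).1.1,
      fun i => (lastBelow_mem (ha i) (hcont s i)).1.2⟩)
    (fun s _ s' _ hss i => lastBelow_mono (ha i) fun x hx =>
      proceeds_antitone H.density hss hx.1)
  refine ⟨c, hc.1, fun i => ?_⟩
  have hci : lastBelow (proceeds e c) (a i) (h i) = c i := congrFun hc.2 i
  have hle : proceeds e c (c i) ≤ h i := by
    rcases (lastBelow_mem (h := h i) (ha i) (hcont c i)).2 with h1 | h1
    · rwa [hci] at h1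
    · rw [← hci, h1, proceeds_zero]
      exact (H.shortfall_pos i).le
  refine ⟨hle, fun hlt => hle.antisymm ?_⟩
  have := le_apply_lastBelow (h := h i) (ha i) (hcont c i) (by rwa [hci])
  rwa [hci] at this

/-- Clearing liquidations are the fixed points of a monotone map. Up to a level `T`, beyond
which nobody sells for profit, every bank sells until it has raised its shortfall, and this part
`b` of the liquidations does not depend on the rest. Above `b`, a bank sells only what it needs
to raise its shortfall with the help of a loan, or all it has if that is not enough; this amount
increases with the liquidations of the other banks. -/
theorem exists_baseline (H : IsMarket M r a h e g p) :
    ∃ b ∈ Icc 0 a, ∀ s ∈ Icc 0 a,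
      (IsEquilibriumAt r a h p (g (∑ j, s j)) (p s) s ↔
        (fun i => max (b i) (lastBelow (cash a e g s i) (a i) (h i))) = s) := by
  obtain ⟨c, hc, hch⟩ := H.exists_fullSale
  have hle : ∀ i, a i ≤ ∑ j, a j := fun i =>
    Finset.single_le_sum (fun j _ => (H.holding_pos j).le) (Finset.mem_univ i)
  obtain ⟨T, hT, hTm, hTm'⟩ := exists_zero_crossing (A := ∑ j, a j)
    (H.continuous_margin c) (H.margin_zero_nonneg hc) (Finset.sum_nonneg fun j _ => (H.holding_pos j).le)
  refine ⟨fun i => min (c i) T, ⟨fun i => le_min (hc.1 i) hT.1,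
    fun i => (min_le_left _ _).trans (hc.2 i)⟩, fun s hs => ?_⟩
  rw [H.isEquilibriumAt_iff hs]
  constructor
  · intro hclear
    -- Below `T`, a clearing vector agrees with `c`.
    have hagree : ∀ i, min (s i) T = min (c i) T := by
      refine min_eq_min_of_forall_lowest fun i hi hlow => ?_
      rcases lt_trichotomy (s i) (c i) with hlt | heq | hlt
      · rw [min_eq_left hlt.le] at hlow
        have hsT : s i < T := by
          by_contra! hTs
          exact hi (by rw [min_eq_right hTs, min_eq_right (hTs.trans hlt.le)])
        have hsa : s i < a i := hlt.trans_le (hc.2 i)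
        have hsol : h i ≤ a i * p s i := by
          by_contra! hins
          exact hsa.ne ((hclear i).1 hins)
        have h1 : proceeds e s (s i) < h i := by
          rw [proceeds_congr e (hs.1 i) hlow]
          exact (strictMono_proceeds H.density c hlt).trans_le (hch i).1
        have h2 := ((hclear i).2 hsol).2.2.2 hsa h1
        rw [margin_congr r e hlow] at h2
        linarith [H.margin_lt_margin hc (hs.1 i) hsT hlt]
      · exact hi (by rw [heq])
      · rw [min_eq_right hlt.le] at hlow
        have h1 : h i < proceeds e s (s i) := by
          rw [← (hch i).2 (hlt.trans_le (hs.2 i)), ← proceeds_congr e (hc.1 i) hlow]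
          exact strictMono_proceeds H.density s hlt
        rcases lt_or_ge (a i * p s i) (h i) with hins | hsol
        · rw [← H.mul_price hs, (hclear i).1 hins] at h1
          exact lt_asymm h1 hins
        · exact h1.not_ge ((hclear i).2 hsol).1
    funext i
    have ha := (H.holding_pos i).le
    have hmem := lastBelow_mem (h := h i) ha (H.cash_continuousOn hs i)
    have hcash : s i ∈ Icc 0 (a i) := ⟨hs.1 i, hs.2 i⟩
    refine le_antisymm (max_le ?_ ?_) ?_
    · exact (hagree i).ge.trans (min_le_left _ _)
    · rcases lt_or_ge (a i * p s i) (h i) with hins | hsol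
      · rw [(hclear i).1 hins]
        exact hmem.1.2
      · rcases hmem.2 with h1 | h1
        · exact ((H.cash_strictMonoOn hs i).le_iff_le hmem.1 hcash).1
            (h1.trans ((hclear i).2 hsol).2.1)
        · rw [h1]
          exact hs.1 i
    · by_contra! hlt
      rw [max_lt_iff, ← hagree i] at hlt
      have hTs : T < s i := by
        by_contra! hTs
        rw [min_eq_left hTs] at hlt
        exact lt_irrefl _ hlt.1
      have h1 : h i < cash a e g s i (s i) :=
        (le_apply_lastBelow ha (H.cash_continuousOn hs i) (hlt.2.trans_le (hs.2 i))).trans_lt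
          (H.cash_strictMonoOn hs i hmem.1 hcash hlt.2)
      have hsol : h i ≤ a i * p s i := by
        by_contra! hins
        rw [cash_self hs, ← H.mul_price hs, (hclear i).1 hins] at h1
        linarith
      have h2 := ((hclear i).2 hsol).2.2.1 h1
      have h3 := H.margin_lt_margin hs hT.1 hTs hTs
      rw [margin_congr r e hagree, hTm' (hTs.trans_le ((hs.2 i).trans (hle i)))] at h3
      linarith
  · intro hfix
    have hfix' : ∀ i, s i = max (min (c i) T) (lastBelow (cash a e g s i) (a i) (h i)) :=
      fun i => (congrFun hfix i).symm
    have hbs : ∀ i, min (c i) T ≤ s i := fun i => by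
      rw [hfix' i]
      exact le_max_left _ _
    have hLs : ∀ i, lastBelow (cash a e g s i) (a i) (h i) ≤ s i := fun i => by
      conv_rhs => rw [hfix' i]
      exact le_max_right _ _
    -- Below `T`, a fixed point agrees with `c`.
    have hagree : ∀ i, min (s i) T = min (c i) T := by
      refine min_eq_min_of_forall_lowest fun i hi hlow => ?_
      have hsb : min (c i) T < s i := (hbs i).lt_of_ne fun heq => hi (by
        rw [← heq, min_assoc, min_self])
      have hcT : c i < T := by
        by_contra! hTc
        rw [min_eq_right hTc] at hsb
        exact hi (by rw [min_eq_right hTc, min_eq_right hsb.le])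
      rw [min_eq_left hcT.le] at hsb
      rw [min_eq_right hsb.le] at hlow
      have hsL : s i = lastBelow (cash a e g s i) (a i) (h i) := by
        rcases max_choice (min (c i) T) (lastBelow (cash a e g s i) (a i) (h i)) with h1 | h1
        · rw [← hfix' i, min_eq_left hcT.le] at h1
          exact absurd h1 hsb.ne'
        · rwa [← hfix' i] at h1
      have hca : c i < a i := hsb.trans_le (hs.2 i)
      have hcm : c i ∈ Icc 0 (a i) := ⟨hc.1 i, hc.2 i⟩
      have h1 : h i ≤ cash a e g s i (c i) := by
        rw [cash, proceeds_update hs e (hc.1 i) hsb.le, proceeds_congr e (hc.1 i) hlow,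
          (hch i).2 hca]
        exact le_add_of_nonneg_right
          (mul_nonneg (sub_nonneg.2 hca.le) (H.haircut_pos (update_mem_Icc hs hcm)).le)
      have h2 : cash a e g s i (s i) ≤ h i := by
        rcases (lastBelow_mem (h := h i) (H.holding_pos i).le
          (H.cash_continuousOn hs i)).2 with h3 | h3
        · rwa [← hsL] at h3
        · rw [← hsL] at h3
          have : 0 ≤ c i := hc.1 i
          linarith
      linarith [H.cash_strictMonoOn hs i hcm ⟨hs.1 i, hs.2 i⟩ hsb]
    intro i
    have ha := (H.holding_pos i).le
    have hcash : s i ∈ Icc 0 (a i) := ⟨hs.1 i, hs.2 i⟩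
    have hmem := lastBelow_mem (h := h i) ha (H.cash_continuousOn hs i)
    have hq := H.haircut_lt_price hs i
    have hloan : s i < a i → h i ≤ cash a e g s i (s i) := fun hsa =>
      (le_apply_lastBelow ha (H.cash_continuousOn hs i) ((hLs i).trans_lt hsa)).trans
        ((H.cash_strictMonoOn hs i).monotoneOn hmem.1 hcash (hLs i))
    -- Either the bank is at its baseline, or it raises no more than its shortfall.
    have hcases : s i = min (c i) T ∨ cash a e g s i (s i) ≤ h i := by
      rcases (hbs i).eq_or_lt with heq | hlt
      · exact Or.inl heq.symm
      right
      have hsL : s i = lastBelow (cash a e g s i) (a i) (h i) := by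
        rcases max_choice (min (c i) T) (lastBelow (cash a e g s i) (a i) (h i)) with h1 | h1
        · rw [← hfix' i] at h1
          exact absurd h1 hlt.ne'
        · rwa [← hfix' i] at h1
      rcases hmem.2 with h3 | h3
      · rwa [← hsL] at h3
      · rw [← hsL] at h3
        have : 0 ≤ min (c i) T := le_min (hc.1 i) hT.1
        linarith
    refine ⟨fun hins => ?_, fun hsol => ⟨?_, ?_, fun hgt => ?_, fun hsa hlt => ?_⟩⟩
    · refine (hs.2 i).eq_of_not_lt fun hsa => ?_
      have h1 := hloan hsa
      rw [cash_self hs, ← H.mul_price hs] at h1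
      nlinarith
    · rcases hcases with heq | h1
      · have hsT : s i ≤ T := heq.trans_le (min_le_right _ _)
        rw [proceeds_congr e (hs.1 i) fun j => min_eq_min_of_le (hagree j) hsT]
        exact ((strictMono_proceeds H.density c).monotone
          (heq.trans_le (min_le_left _ _))).trans (hch i).1
      · rw [cash_self hs] at h1
        nlinarith [mul_nonneg (sub_nonneg.2 (hs.2 i)) (H.haircut_pos hs).le]
    · rcases (hs.2 i).eq_or_lt with heq | hlt
      · rw [cash_self hs, ← H.mul_price hs, heq]
        linarith
      · exact hloan hlt
    · rcases hcases with heq | h1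
      · have hsT : s i ≤ T := heq.trans_le (min_le_right _ _)
        rw [margin_congr r e fun j => min_eq_min_of_le (hagree j) hsT]
        exact hTm.trans (H.margin_antitone c hsT)
      · exact absurd h1 hgt.not_ge
    · rcases lt_or_ge (s i) T with hsT | hTs
      · have hci : s i = c i := by
          have h1 := hagree i
          rw [min_eq_left hsT.le] at h1
          rcases min_choice (c i) T with h2 | h2
          · rw [h1, h2]
          · rw [h2] at h1
            exact absurd h1 hsT.ne
        have h1 := (hch i).2 (hci ▸ hsa)
        rw [proceeds_congr e (hs.1 i) fun j => min_eq_min_of_le (hagree j) hsT.le, hci, h1] at hlt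
        exact absurd hlt (lt_irrefl _)
      · refine (H.margin_antitone s hTs).trans ?_
        rw [margin_congr r e hagree, hTm' (hTs.trans_lt (hsa.trans_le (hle i)))]

theorem clearingLiquidations_eq (H : IsMarket M r a h e g p) :
    clearingLiquidations r a h p g =
      {s | s ∈ Icc 0 a ∧ IsEquilibriumAt r a h p (g (∑ j, s j)) (p s) s} := by
  ext s
  constructor
  · rintro ⟨⟨q, qb⟩, ⟨s', hs', hq, hqb⟩, hs⟩
    obtain rfl : s = s' := H.equilibrium_unique hs hs'
    obtain rfl : qb = p s := funext hqb
    obtain rfl : q = g (∑ j, s j) := hq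
    exact ⟨mem_admissible.1 hs.1, hs⟩
  · rintro ⟨-, hs⟩
    exact ⟨(g (∑ j, s j), p s), ⟨s, hs, rfl, fun _ => rfl⟩, hs⟩

theorem clearing_lattice (H : IsMarket M r a h e g p) :
    (∃ l, IsLeast (clearingLiquidations r a h p g) l) ∧
      (∃ u, IsGreatest (clearingLiquidations r a h p g) u) ∧
        IsLatticeIn (clearingLiquidations r a h p g) := by
  obtain ⟨b, hb, hbs⟩ := H.exists_baseline
  have ha : ∀ i, 0 ≤ a i := fun i => (H.holding_pos i).le
  have heq : clearingLiquidations r a h p g = {s | s ∈ Icc 0 a ∧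
      (fun i => max (b i) (lastBelow (cash a e g s i) (a i) (h i))) = s} := by
    rw [H.clearingLiquidations_eq]
    ext s
    exact and_congr_right fun hs => hbs s hs
  rw [heq]
  refine knaster_tarski_Icc (Φ := fun s i =>
    max (b i) (lastBelow (cash a e g s i) (a i) (h i))) (show 0 ≤ a from ha) ?_ ?_
  · exact fun s hs => ⟨fun i => le_max_of_le_left (hb.1 i), fun i => max_le (hb.2 i)
      (lastBelow_mem (ha i) (H.cash_continuousOn hs i)).1.2⟩
  · exact fun s hs s' hs' hss i => max_le_max le_rfl
      (lastBelow_mono (ha i) fun x hx => H.cash_antitone hs hs' hss hx)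

end IsMarket

end FireSale


open FireSale in
theorem theorem2 (n : ℕ) (M r : ℝ) (a h : Fin n → ℝ) (f g : ℝ → ℝ)
    (hr : 0 ≤ r) (ha : ∀ i, 0 < a i) (hh : ∀ i, 0 < h i) (hM : ∑ i, a i ≤ M)
    (hf : DensityAssumption M f) (hg : HaircutAssumption M a (lobPrice f) g) :
    (∃ Qmax Qmin : ℝ × (Fin n → ℝ),
      IsGreatest (clearingPrices r a h (lobPrice f) g) Qmax ∧
      IsLeast (clearingPrices r a h (lobPrice f) g) Qmin ∧
      Qmin ≤ Qmax) ∧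
    IsLatticeIn (clearingLiquidations r a h (lobPrice f) g) := by
  have hM0 : 0 ≤ M := (Finset.sum_nonneg fun i _ => (ha i).le).trans hM
  have he := hf.isDensity_IccExtend hM0
  have H : IsMarket M r a h (IccExtend hM0 ((Icc 0 M).domRestrict f)) g (lobPrice f) :=
    { rate_nonneg := hr
      holding_pos := ha
      shortfall_pos := hh
      sum_le := hM
      density := he
      price_eq := fun s hs i => lobPrice_eq_integral
        (fun x hx => (IccExtend_of_mem hM0 ((Icc 0 M).domRestrict f) hx).symm) he hs.1
        ((Finset.sum_le_sum fun j _ => hs.2 j).trans hM) i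
      haircut := hg }
  obtain ⟨⟨l, hl⟩, ⟨u, hu⟩, hlat⟩ := H.clearing_lattice
  -- Prices decrease in the liquidations, so that the order is reversed.
  have hmem : ∀ s ∈ clearingLiquidations r a h (lobPrice f) g,
      (g (∑ j, s j), lobPrice f s) ∈ clearingPrices r a h (lobPrice f) g := fun s hs => by
    rw [H.clearingLiquidations_eq] at hs
    exact ⟨s, hs.2, rfl, fun _ => rfl⟩
  have hex : ∀ Q ∈ clearingPrices r a h (lobPrice f) g,
      ∃ s ∈ clearingLiquidations r a h (lobPrice f) g,
        Q = (g (∑ j, s j), lobPrice f s) := fun Q hQ => by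
    obtain ⟨s, hs, hq, hqb⟩ := hQ
    exact ⟨s, ⟨Q, ⟨s, hs, hq, hqb⟩, hs⟩, Prod.ext hq (funext hqb)⟩
  have hanti : ∀ s ∈ clearingLiquidations r a h (lobPrice f) g,
      ∀ s' ∈ clearingLiquidations r a h (lobPrice f) g, s ≤ s' →
        ((g (∑ j, s' j), lobPrice f s') : ℝ × (Fin n → ℝ)) ≤
          (g (∑ j, s j), lobPrice f s) := fun s hs s' hs' hss => by
    rw [H.clearingLiquidations_eq] at hs hs'
    exact ⟨H.haircut_antitone hs.1 hs'.1 hss, H.price_antitone hs.1 hs'.1 hss⟩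
  refine ⟨⟨_, _, ⟨hmem l hl.1, fun Q hQ => ?_⟩, ⟨hmem u hu.1, fun Q hQ => ?_⟩,
    hanti l hl.1 u hu.1 (hl.2 hu.1)⟩, hlat⟩
  · obtain ⟨s, hs, rfl⟩ := hex Q hQ
    exact hanti l hl.1 s hs (hl.2 hs)
  · obtain ⟨s, hs, rfl⟩ := hex Q hQ
    exact hanti s hs u hu.1 (hu.2 hs)
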